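/- For a positive integer $n$ and a set $S$ of integers, let $\Gamma(\mathbb{Z}_n,S)$ be the circulant digraph with vertex set $\mathbb{Z}_n=\mathbb{Z}/n\mathbb{Z}$ and directed edges $(g,g+s)$ for all $g\in\mathbb{Z}_n$ and all $s\in S$ (with $s$ read modulo $n$). A vertex $u$ dominates a vertex $v$ if $u=v$ or $(u,v)$ is a directed edge. The domination number $\gamma(\mathbb{Z}_n,S)$ is the smallest cardinality of a set $D\subseteq\mathbb{Z}_n$ such that every vertex is dominated by some vertex in $D$. Let $d\ge 2$ and $k\ge 1$ be integers. (1) If $e$ is an integer with $2\le e\le d$ and $d\le k+e+1$, then $$\gamma(\mathbb{Z}_{dk+e},\{-1,1,2,\ldots,d-2\})=\gamma(\mathbb{Z}_{dk+e},\{1,2,\ldots,d-1\})=k+1.$$ (2) If $d\le 2k+2$, then $$\gamma(\mathbb{Z}_{2dk-d+2},\{1,2,\ldots,d-2,dk\})=2k.$$ -/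

import Mathlib

/-- The Cayley digraph of an additive group `G` with connection set `S`: its directed edges are the
pairs `(g, g + s)` with `g ∈ G` and `s ∈ S`. -/
def addCayleyDigraph {G : Type*} [AddGroup G] (S : Set G) : Digraph G where
  Adj g h := ∃ s ∈ S, h = g + s

/-- The vertex `u` dominates the vertex `v` if `u = v` or there is a directed edge `u → v`. -/
def Digraph.Dominates {V : Type*} (Γ : Digraph V) (u v : V) : Prop :=
  u = v ∨ Γ.Adj u v

/-- A set `D` of vertices is dominating if every vertex is dominated by some member of `D`. -/
def Digraph.IsDominatingSet {V : Type*} (Γ : Digraph V) (D : Set V) : Prop :=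
  ∀ v : V, ∃ u ∈ D, Γ.Dominates u v

/-- The domination number: the smallest cardinality of a dominating set. It takes values in `ℕ∞`;
the infimum is over a non-empty family (the set of all vertices is dominating), hence attained. -/
noncomputable def Digraph.dominationNumber {V : Type*} (Γ : Digraph V) : ℕ∞ :=
  ⨅ (D : Set V) (_ : Γ.IsDominatingSet D), D.encard

/-- The domination number of the circulant digraph on `ZMod n` whose connection set consists of the
residues modulo `n` of the elements of a set `S` of integers. -/
noncomputable def circulantDominationNumber (n : ℕ) (S : Set ℤ) : ℕ∞ :=
  (addCayleyDigraph ((fun s : ℤ => (s : ZMod n)) '' S)).dominationNumber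

/-! Every vertex dominates at most `d` vertices, so a dominating set has at least `n / d` elements;
in each case a matching set of translates exists. In (1), `S ∪ {0}` is `d` consecutive integers and
its translates tile. In (2), it is only `d - 1` consecutive integers plus the jump `d * k`, which
must fill the gaps. -/

/-- If the connection set has fewer than `d` elements, then more than `m` vertices are needed to
dominate a circulant digraph on more than `m * d` vertices. -/
theorem succ_le_circulantDominationNumber {n d m : ℕ} {S : Set ℤ} (T : Finset ℤ)
    (hST : S ⊆ T) (hT : T.card + 1 ≤ d) (hn : m * d < n) :
    (m : ℕ∞) + 1 ≤ circulantDominationNumber n S := by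
  classical
  have : NeZero n := ⟨by omega⟩
  refine le_iInf₂ fun D hD => ?_
  obtain ⟨E, rfl⟩ := D.toFinite.exists_finset_coe
  rw [Set.encard_coe_eq_coe_finsetCard]
  have hcover : (Finset.univ : Finset (ZMod n)) ⊆
      (E ×ˢ insert 0 T).image fun p => p.1 + ((p.2 : ℤ) : ZMod n) := by
    intro v _
    obtain ⟨u, hu, rfl | ⟨_, ⟨s, hs, rfl⟩, rfl⟩⟩ := hD v
    · exact Finset.mem_image.2 ⟨(u, 0), by simpa using hu, by simp⟩
    · exact Finset.mem_image.2 ⟨(u, s), by simpa using ⟨hu, Or.inr (hST hs)⟩, rfl⟩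
  have hcard : n ≤ E.card * d := by
    calc n = (Finset.univ : Finset (ZMod n)).card := by simp [ZMod.card]
      _ ≤ (E ×ˢ insert 0 T).card := (Finset.card_le_card hcover).trans Finset.card_image_le
      _ ≤ E.card * d := by
        rw [Finset.card_product]
        exact Nat.mul_le_mul_left _ ((Finset.card_insert_le _ _).trans hT)
  have hlt : m < E.card := lt_of_mul_lt_mul_right (hn.trans_le hcard) (Nat.zero_le d)
  exact_mod_cast hlt

/-- A family of `m` integers whose translates of `S ∪ {0}` meet every residue class modulo `n`
bounds the domination number by `m`. -/
theorem circulantDominationNumber_le {n m : ℕ} [NeZero n] {S : Set ℤ} (f : ℕ → ℤ)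
    (hf : ∀ x : ℤ, 0 ≤ x → x < n → ∃ i < m, ∃ s ∈ insert 0 S, (n : ℤ) ∣ x - (f i + s)) :
    circulantDominationNumber n S ≤ m := by
  classical
  let E : Finset (ZMod n) := (Finset.range m).image fun i => (f i : ZMod n)
  have hE : (addCayleyDigraph ((fun s : ℤ => (s : ZMod n)) '' S)).IsDominatingSet
      (E : Set (ZMod n)) := by
    intro v
    obtain ⟨i, hi, s, hs, hdvd⟩ := hf v.val (by positivity) (by exact_mod_cast v.val_lt)
    have hv : v = f i + s := by
      have h := (ZMod.intCast_zmod_eq_zero_iff_dvd _ n).2 hdvd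
      push_cast at h
      rwa [ZMod.natCast_zmod_val, sub_eq_zero] at h
    refine ⟨f i, Finset.mem_coe.2 (Finset.mem_image_of_mem _ (Finset.mem_range.2 hi)), ?_⟩
    rcases hs with rfl | hs
    · exact Or.inl (by simp [hv])
    · exact Or.inr ⟨s, ⟨s, hs, rfl⟩, hv⟩
  calc circulantDominationNumber n S ≤ (E : Set (ZMod n)).encard := iInf₂_le _ hE
    _ = E.card := Set.encard_coe_eq_coe_finsetCard E
    _ ≤ m := by exact_mod_cast Finset.card_image_le.trans (Finset.card_range m).le

theorem exists_eq_mul_add {d m : ℕ} {x : ℤ} (hd : 0 < d) (hx : 0 ≤ x) (hxm : x < d * m) :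
    ∃ q < m, ∃ r < d, x = d * q + r := by
  lift x to ℕ using hx
  refine ⟨x / d, Nat.div_lt_of_lt_mul (by exact_mod_cast hxm), x % d, Nat.mod_lt _ hd, ?_⟩
  exact_mod_cast (Nat.div_add_mod x d).symm

/-- If `S ∪ {0}` contains `d` consecutive integers, then `m` translates of it cover `n ≤ d * m`
residues. -/
theorem circulantDominationNumber_le_of_Ico {n d m : ℕ} [NeZero n] {S : Set ℤ} (hd : 0 < d)
    (a : ℤ) (hS : Set.Ico a (a + d) ⊆ insert 0 S) (hn : n ≤ d * m) :
    circulantDominationNumber n S ≤ m := by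
  refine circulantDominationNumber_le (fun i => d * i - a) fun x hx hxn => ?_
  obtain ⟨q, hq, r, hr, rfl⟩ := exists_eq_mul_add (m := m) hd hx
    (hxn.trans_le (by exact_mod_cast hn))
  exact ⟨q, hq, a + r, hS ⟨by omega, by omega⟩, ⟨0, by ring⟩⟩

/-- Cut the residues into `2 * k` blocks of length `d`. Each translate covers its own block but one
point, and its jump lands on the point missed in the block `k` places away. -/
theorem circulantDominationNumber_Icc_union_le {d k : ℕ} (hd : 2 ≤ d) (hk : 1 ≤ k) :
    circulantDominationNumber (2 * d * k - d + 2) (Set.Icc 1 ((d : ℤ) - 2) ∪ {(d : ℤ) * k}) ≤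
      (2 * k : ℕ) := by
  have hdk : d ≤ 2 * d * k := by nlinarith
  -- Early blocks miss their last point, late ones their first.
  refine circulantDominationNumber_le (fun i => if i < k then (d : ℤ) * i else d * i + 1)
    fun x hx hxn => ?_
  have hN : ((2 * d * k - d + 2 : ℕ) : ℤ) = 2 * d * k - d + 2 := by
    push_cast [Nat.cast_sub hdk]; ring
  rw [hN] at hxn ⊢
  obtain ⟨q, hq, r, hr, rfl⟩ := exists_eq_mul_add (d := d) (m := 2 * k) (by omega) hx
    (hxn.trans_le (by push_cast; have : (2 : ℤ) ≤ d := mod_cast hd; linarith))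
  have hmem : ∀ t : ℤ, 0 ≤ t → t ≤ d - 2 →
      t ∈ insert 0 (Set.Icc 1 ((d : ℤ) - 2) ∪ {(d : ℤ) * k}) := fun t h0 h1 => by
    rcases h0.eq_or_lt with rfl | h
    · exact Or.inl rfl
    · exact Or.inr (Or.inl ⟨by omega, h1⟩)
  have hmul : (d : ℤ) * k ∈ insert 0 (Set.Icc 1 ((d : ℤ) - 2) ∪ {(d : ℤ) * k}) :=
    Or.inr (Or.inr rfl)
  by_cases hqk : q < k
  · by_cases hrd : r + 1 = d
    -- The jump wraps around once: `d * (q + k) + 1 + d * k = (d * q + d - 1) + n`.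
    · refine ⟨q + k, by omega, d * k, hmul, -1, ?_⟩
      have hr' : (r : ℤ) = d - 1 := by omega
      rw [if_neg (by omega), hr']
      push_cast
      ring
    · exact ⟨q, hq, r, hmem r (by omega) (by omega), 0, by rw [if_pos hqk]; ring⟩
  · by_cases hr0 : r = 0
    · refine ⟨q - k, by omega, d * k, hmul, 0, ?_⟩
      rw [if_pos (by omega), hr0, Nat.cast_sub (by omega)]
      push_cast
      ring
    · exact ⟨q, hq, r - 1, hmem _ (by omega) (by omega), 0, by rw [if_neg hqk]; ring⟩

theorem mainTheorem4 (d k : ℕ) (hd : 2 ≤ d) (hk : 1 ≤ k) :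
    (∀ e : ℕ, 2 ≤ e → e ≤ d → d ≤ k + e + 1 →
      circulantDominationNumber (d * k + e) ({-1} ∪ Set.Icc 1 ((d : ℤ) - 2)) = k + 1 ∧
      circulantDominationNumber (d * k + e) (Set.Icc 1 ((d : ℤ) - 1)) = k + 1) ∧
    (d ≤ 2 * k + 2 →
      circulantDominationNumber (2 * d * k - d + 2)
        (Set.Icc 1 ((d : ℤ) - 2) ∪ {(d : ℤ) * k}) = 2 * k) := by
  refine ⟨fun e he hed _ => ?_, fun _ => ?_⟩
  · have : NeZero (d * k + e) := ⟨by omega⟩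
    have hle : d * k + e ≤ d * (k + 1) := by rw [mul_add]; omega
    have hlt : k * d < d * k + e := by rw [mul_comm]; omega
    constructor <;> apply le_antisymm
    -- With `0` included, the run is `-1, 0, …, d - 2`.
    · refine (circulantDominationNumber_le_of_Ico (by omega) (-1) ?_ hle).trans
        (Nat.cast_succ k).le
      rintro x ⟨h1, h2⟩
      simp only [Set.mem_insert_iff, Set.mem_union, Set.mem_singleton_iff, Set.mem_Icc]
      omega
    · refine succ_le_circulantDominationNumber (insert (-1) (Finset.Icc 1 ((d : ℤ) - 2)))
        (by simp) ?_ hlt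
      have := Finset.card_insert_le (-1) (Finset.Icc 1 ((d : ℤ) - 2))
      rw [Int.card_Icc] at this
      omega
    · refine (circulantDominationNumber_le_of_Ico (by omega) 0 ?_ hle).trans (Nat.cast_succ k).le
      rintro x ⟨h1, h2⟩
      simp only [Set.mem_insert_iff, Set.mem_Icc]
      omega
    · refine succ_le_circulantDominationNumber (Finset.Icc 1 ((d : ℤ) - 1)) (by simp) ?_ hlt
      rw [Int.card_Icc]
      omega
  · apply le_antisymm (mod_cast circulantDominationNumber_Icc_union_le hd hk)
    -- The two sides differ by exactly 2.
    have hlt : (2 * k - 1) * d < 2 * d * k - d + 2 := by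
      rw [Nat.sub_mul, one_mul, mul_right_comm]
      omega
    have h := succ_le_circulantDominationNumber
      (S := Set.Icc 1 ((d : ℤ) - 2) ∪ {(d : ℤ) * k})
      (insert ((d : ℤ) * k) (Finset.Icc 1 ((d : ℤ) - 2))) (by simp) (d := d) (by
        have := Finset.card_insert_le ((d : ℤ) * k) (Finset.Icc 1 ((d : ℤ) - 2))
        rw [Int.card_Icc] at this
        omega) hlt
    have h2 : ((2 * k - 1 : ℕ) : ℕ∞) + 1 = 2 * k := by
      have : 2 * k - 1 + 1 = 2 * k := by omega
      exact_mod_cast this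
    rwa [h2] at h
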